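/- Let $(\mathcal{C}, e, \cdot)$ be a monoidal category. The category $\Sigma\Pi\mathcal{C}$ of polynomials in $\mathcal{C}$ has as objects formal expressions $\sum_{i\in I}\prod_{a\in A_i}c_{i,a}$, given by a set $I$, sets $A_i$ $(i\in I)$ and objects $c_{i,a}$ of $\mathcal{C}$. A morphism $\phi\colon\sum_{i\in I}\prod_{a\in A_i}c_{i,a}\to\sum_{j\in J}\prod_{b\in B_j}d_{j,b}$ consists of a function $\phi\colon I\to J$, functions $\phi^\sharp_i\colon B_{\phi i}\to A_i$ and morphisms $\phi_{i,b}\colon c_{i,\phi^\sharp_i b}\to d_{\phi i,b}$ of $\mathcal{C}$ for $i\in I$, $b\in B_{\phi i}$. It is a monoidal category $(\Sigma\Pi\mathcal{C},e,\triangleleft)$ under the composition product $$\Bigl(\sum_{i\in I}\prod_{a\in A_i}u_{i,a}\Bigr)\triangleleft\Bigl(\sum_{j\in J}\prod_{b\in B_j}v_{j,b}\Bigr)=\sum_{i\in I}\prod_{a\in A_i}\sum_{j\in J}\prod_{b\in B_j}(u_{i,a}\cdot v_{j,b})\cong\sum_{i\in I}\ \sum_{\bar\jmath\colon A_i\to J}\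 \prod_{a\in A_i}\ \prod_{b\in B_{\bar\jmath a}}(u_{i,a}\cdot v_{\bar\jmath a,b}),$$ whose unit is $e$, regarded as a polynomial with one position and one direction, and whose structure isomorphisms are induced by those of $\mathcal{C}$. The free coproduct completion $\Sigma\mathcal{C}^{\mathrm{op}}$ of $\mathcal{C}^{\mathrm{op}}$ has as objects the formal coproducts $\sum_{i\in I}c_i$ (a set $I$ and objects $c_i$ of $\mathcal{C}$); a morphism $\sum_{i\in I}c_i\to\sum_{j\in J}d_j$ consists of a function $\phi\colon I\to J$ and morphisms $d_{\phi i}\to c_i$ of $\mathcal{C}$ for $i\in I$. It is monoidal under Day convolution, $(\sum_{i\in I}c_i)\odot(\sum_{j\in J}d_j)=\sum_{(i,j)\in I\times J}c_i\cdot d_j$, with unit $e$. For a small category $\mathcal{A}$ enriched over $(\Sigma\mathcal{C}^{\mathrm{op}},e,\odot)$ write the hom-objects as $\sum_{f\colon x\to y}|f|$. The identities of $\mathcal{A}$ then consist of morphisms $\mathrm{id}_x\colon x\to x$ and maps $\eta_x\colon|\mathrm{id}_x|\to e$ of $\mathcal{C}$, and the composition of $\mathcal{A}$ consists of composites $gf\colon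 x\to z$ and maps $\mu_{f,g}\colon|gf|\to|f|\cdot|g|$ of $\mathcal{C}$ for $f\colon x\to y$, $g\colon y\to z$. An enriched cofunctor $\Phi\colon\mathcal{A}\nrightarrow\mathcal{B}$ between such categories consists of a function $\Phi\colon\mathrm{Ob}\,\mathcal{A}\to\mathrm{Ob}\,\mathcal{B}$ and, for each $a\in\mathcal{A}$ and each $f\colon\Phi a\to b$ in $\mathcal{B}$, a morphism $\Phi^\sharp_a f\colon a\to x$ of $\mathcal{A}$ with $\Phi x=b$ and a map $\Phi_{a,f}\colon|\Phi^\sharp_a f|\to|f|$ of $\mathcal{C}$. These must satisfy the following. - Identities: $\Phi^\sharp_a(\mathrm{id}_{\Phi a})=\mathrm{id}_a$ and $\eta_{\Phi a}\circ\Phi_{a,\mathrm{id}_{\Phi a}}=\eta_a$. - Composites: for $f\colon\Phi a\to b$ with $\Phi^\sharp_a f\colon a\to x$, and $g\colon b\to b'$, one has $\Phi^\sharp_a(gf)=\Phi^\sharp_x(g)\,\Phi^\sharp_a(f)$ and $\mu_{f,g}\circ\Phi_{a,gf}=(\Phi_{a,f}\cdot\Phi_{x,g})\circ\mu_{\Phi^\sharp_a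 f,\Phi^\sharp_x g}$. Enriched cofunctors compose by $(\Psi\Phi)^\sharp_a f=\Phi^\sharp_a(\Psi^\sharp_{\Phi a}f)$ and $(\Psi\Phi)_{a,f}=\Psi_{\Phi a,f}\circ\Phi_{a,\Psi^\sharp_{\Phi a}f}$. **Theorem.** The category of comonoids in the monoidal category $(\Sigma\Pi\mathcal{C},e,\triangleleft)$ is equivalent to the category of small $(\Sigma\mathcal{C}^{\mathrm{op}},e,\odot)$-enriched categories and enriched cofunctors. -/

import Mathlib

open CategoryTheory MonoidalCategory Limits

universe w v u

/-- The pentagon identity, written with `⊗ₘ` only. -/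
theorem pentagon_tensorHom {C : Type u} [Category.{v} C] [MonoidalCategory C] (W X Y Z : C) :
    ((α_ W X Y).hom ⊗ₘ 𝟙 Z) ≫ (α_ W (X ⊗ Y) Z).hom ≫ (𝟙 W ⊗ₘ (α_ X Y Z).hom) =
      (α_ (W ⊗ X) Y Z).hom ≫ (α_ W X (Y ⊗ Z)).hom := by
  simp only [id_tensorHom, tensorHom_id, pentagon]

/-- The triangle identity, written with `⊗ₘ` only. -/
theorem triangle_tensorHom {C : Type u} [Category.{v} C] [MonoidalCategory C] (X Y : C) :
    (α_ X (𝟙_ C) Y).hom ≫ (𝟙 X ⊗ₘ (λ_ Y).hom) = (ρ_ X).hom ⊗ₘ 𝟙 Y := by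
  simp only [id_tensorHom, tensorHom_id, triangle]

/-- An object `∑ (i : I), ∏ (a : A i), c i a` of the category of polynomials in `C`. -/
structure PolyIn (C : Type u) : Type (max u (w + 1)) where
  /-- positions -/
  pos : Type w
  /-- directions at a position -/
  dir : pos → Type w
  /-- predicates -/
  pred : (i : pos) → dir i → C

namespace PolyIn

variable {C : Type u} [Category.{v} C]

/-- A morphism of polynomials: forward on positions, backward on directions, and forward on
predicates. -/
structure Hom (P Q : PolyIn.{w} C) : Type (max v w) where
  /-- on-positions function -/
  onPos : P.pos → Q.pos
  /-- on-directions functions -/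
  onDir : (i : P.pos) → Q.dir (onPos i) → P.dir i
  /-- on-predicates maps -/
  onPred : (i : P.pos) → (b : Q.dir (onPos i)) → (P.pred i (onDir i b) ⟶ Q.pred (onPos i) b)

instance category : Category (PolyIn.{w} C) where
  Hom P Q := Hom P Q
  id P := ⟨fun i => i, fun _ a => a, fun i a => 𝟙 (P.pred i a)⟩
  comp f g :=
    ⟨fun i => g.onPos (f.onPos i),
     fun i c => f.onDir i (g.onDir (f.onPos i) c),
     fun i c => f.onPred i (g.onDir (f.onPos i) c) ≫ g.onPred (f.onPos i) c⟩
  id_comp f := by simp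
  comp_id f := by simp
  assoc f g h := by simp

/-- Two morphisms with the same position and direction functions agree as soon as their predicate
maps agree. -/
theorem hom_mk_congr {P Q : PolyIn.{w} C} {p : P.pos → Q.pos}
    {d : (i : P.pos) → Q.dir (p i) → P.dir i}
    {m m' : (i : P.pos) → (b : Q.dir (p i)) → (P.pred i (d i b) ⟶ Q.pred (p i) b)}
    (h : ∀ i b, m i b = m' i b) :
    (Hom.mk p d m : P ⟶ Q) = Hom.mk p d m' := by
  have : m = m' := funext fun i => funext fun b => h i b
  rw [this]

variable [MonoidalCategory C]

/-- The monoidal unit `e`, seen as the polynomial with one position and one direction. -/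
def compUnit : PolyIn.{w} C := ⟨PUnit, fun _ => PUnit, fun _ _ => 𝟙_ C⟩

/-- The composition product
`(∑ i, ∏ a, u i a) ◁ (∑ j, ∏ b, v j b) = ∑ i, ∏ a, ∑ j, ∏ b, (u i a ⊗ v j b)`,
written out by distributivity of products over coproducts as
`∑ (i, j̄ : A i → J), ∏ (a : A i, b : B (j̄ a)), (u i a ⊗ v (j̄ a) b)`. -/
def compProd (P Q : PolyIn.{w} C) : PolyIn.{w} C where
  pos := Σ i : P.pos, P.dir i → Q.pos
  dir x := Σ a : P.dir x.1, Q.dir (x.2 a)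
  pred x y := P.pred x.1 y.1 ⊗ Q.pred (x.2 y.1) y.2

/-- The composition product of two morphisms. -/
def compProdMap {P P' Q Q' : PolyIn.{w} C} (f : P ⟶ P') (g : Q ⟶ Q') :
    compProd P Q ⟶ compProd P' Q' :=
  Hom.mk
    (fun x => ⟨f.onPos x.1, fun c => g.onPos (x.2 (f.onDir x.1 c))⟩)
    (fun x y => ⟨f.onDir x.1 y.1, g.onDir (x.2 (f.onDir x.1 y.1)) y.2⟩)
    (fun x y => f.onPred x.1 y.1 ⊗ₘ g.onPred (x.2 (f.onDir x.1 y.1)) y.2)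

/-- The associator, induced by that of `C`. -/
def compAssociator (P Q R : PolyIn.{w} C) :
    compProd (compProd P Q) R ≅ compProd P (compProd Q R) where
  hom := Hom.mk
    (fun x => ⟨x.1.1, fun a => ⟨x.1.2 a, fun b => x.2 ⟨a, b⟩⟩⟩)
    (fun _ y => ⟨⟨y.1, y.2.1⟩, y.2.2⟩)
    (fun _ _ => (α_ _ _ _).hom)
  inv := Hom.mk
    (fun x => ⟨⟨x.1, fun a => (x.2 a).1⟩, fun y => (x.2 y.1).2 y.2⟩)
    (fun _ y => ⟨y.1.1, ⟨y.1.2, y.2⟩⟩)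
    (fun _ _ => (α_ _ _ _).inv)
  hom_inv_id := hom_mk_congr fun _ _ => Iso.hom_inv_id _
  inv_hom_id := hom_mk_congr fun _ _ => Iso.inv_hom_id _

/-- The left unitor, induced by that of `C`. -/
def compLeftUnitor (P : PolyIn.{w} C) : compProd compUnit P ≅ P where
  hom := Hom.mk (fun x => x.2 PUnit.unit) (fun _ b => ⟨PUnit.unit, b⟩) (fun _ _ => (λ_ _).hom)
  inv := Hom.mk (fun i => ⟨PUnit.unit, fun _ => i⟩) (fun _ y => y.2) (fun _ _ => (λ_ _).inv)
  hom_inv_id := hom_mk_congr fun _ _ => Iso.hom_inv_id _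
  inv_hom_id := hom_mk_congr fun _ _ => Iso.inv_hom_id _

/-- The right unitor, induced by that of `C`. -/
def compRightUnitor (P : PolyIn.{w} C) : compProd P compUnit ≅ P where
  hom := Hom.mk (fun x => x.1) (fun _ a => ⟨a, PUnit.unit⟩) (fun _ _ => (ρ_ _).hom)
  inv := Hom.mk (fun i => ⟨i, fun _ => PUnit.unit⟩) (fun _ y => y.1) (fun _ _ => (ρ_ _).inv)
  hom_inv_id := hom_mk_congr fun _ _ => Iso.hom_inv_id _
  inv_hom_id := hom_mk_congr fun _ _ => Iso.inv_hom_id _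

instance monoidalCategoryStruct : MonoidalCategoryStruct (PolyIn.{w} C) where
  tensorObj := compProd
  whiskerLeft P _ _ g := compProdMap (𝟙 P) g
  whiskerRight f Q := compProdMap f (𝟙 Q)
  tensorHom := compProdMap
  tensorUnit := compUnit
  associator := compAssociator
  leftUnitor := compLeftUnitor
  rightUnitor := compRightUnitor

/-- The monoidal category `(ΣΠC, e, ◁)` of polynomials in `C` under the composition product. -/
instance monoidalCategory : MonoidalCategory (PolyIn.{w} C) :=
  MonoidalCategory.ofTensorHom
    (id_tensorHom_id := fun _ _ => hom_mk_congr fun _ _ => id_tensorHom_id _ _)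
    (id_tensorHom := fun _ _ _ _ => rfl)
    (tensorHom_id := fun _ _ => rfl)
    (tensorHom_comp_tensorHom := fun _ _ _ _ =>
      hom_mk_congr fun _ _ => tensorHom_comp_tensorHom _ _ _ _)
    (associator_naturality := fun _ _ _ => hom_mk_congr fun _ _ => associator_naturality _ _ _)
    (leftUnitor_naturality := fun f => hom_mk_congr fun x b =>
      (congrArg (· ≫ _) (id_tensorHom _ _)).trans
        (leftUnitor_naturality (f.onPred (x.2 PUnit.unit) b)))
    (rightUnitor_naturality := fun f => hom_mk_congr fun x b =>
      (congrArg (· ≫ _) (tensorHom_id _ _)).trans (rightUnitor_naturality (f.onPred x.1 b)))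
    (pentagon := fun _ _ _ _ => hom_mk_congr fun _ _ => pentagon_tensorHom _ _ _ _)
    (triangle := fun _ _ => hom_mk_congr fun _ _ => triangle_tensorHom _ _)

end PolyIn

namespace DayFormalCoproduct

variable {D : Type u} [Category.{v} D]

/-- Two morphisms of formal coproducts with the same index function agree as soon as their
components agree. -/
theorem hom_mk_congr {X Y : FormalCoproduct.{w} D} {p : X.I → Y.I}
    {m m' : (i : X.I) → (X.obj i ⟶ Y.obj (p i))} (h : ∀ i, m i = m' i) :
    (FormalCoproduct.Hom.mk p m : X ⟶ Y) = FormalCoproduct.Hom.mk p m' := by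
  have : m = m' := funext h
  rw [this]

variable [MonoidalCategory D]

/-- Day convolution of formal coproducts:
`(∑ i, c i) ⊙ (∑ j, d j) = ∑ (i, j), c i ⊗ d j`. -/
def tensor (X Y : FormalCoproduct.{w} D) : FormalCoproduct.{w} D :=
  ⟨X.I × Y.I, fun p => X.obj p.1 ⊗ Y.obj p.2⟩

/-- Day convolution of morphisms of formal coproducts. -/
def tensorMap {X X' Y Y' : FormalCoproduct.{w} D} (f : X ⟶ X') (g : Y ⟶ Y') :
    tensor X Y ⟶ tensor X' Y' :=
  FormalCoproduct.Hom.mk (fun p => (f.f p.1, g.f p.2)) (fun p => f.φ p.1 ⊗ₘ g.φ p.2)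

instance monoidalCategoryStruct : MonoidalCategoryStruct (FormalCoproduct.{w} D) where
  tensorObj := tensor
  whiskerLeft X _ _ g := tensorMap (𝟙 X) g
  whiskerRight f Y := tensorMap f (𝟙 Y)
  tensorHom := tensorMap
  tensorUnit := ⟨PUnit, fun _ => 𝟙_ D⟩
  associator _ _ _ :=
    { hom := FormalCoproduct.Hom.mk (fun p => (p.1.1, (p.1.2, p.2))) (fun _ => (α_ _ _ _).hom)
      inv := FormalCoproduct.Hom.mk (fun p => ((p.1, p.2.1), p.2.2)) (fun _ => (α_ _ _ _).inv)
      hom_inv_id := hom_mk_congr fun _ => Iso.hom_inv_id _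
      inv_hom_id := hom_mk_congr fun _ => Iso.inv_hom_id _ }
  leftUnitor _ :=
    { hom := FormalCoproduct.Hom.mk (fun p => p.2) (fun _ => (λ_ _).hom)
      inv := FormalCoproduct.Hom.mk (fun i => (PUnit.unit, i)) (fun _ => (λ_ _).inv)
      hom_inv_id := hom_mk_congr fun _ => Iso.hom_inv_id _
      inv_hom_id := hom_mk_congr fun _ => Iso.inv_hom_id _ }
  rightUnitor _ :=
    { hom := FormalCoproduct.Hom.mk (fun p => p.1) (fun _ => (ρ_ _).hom)
      inv := FormalCoproduct.Hom.mk (fun i => (i, PUnit.unit)) (fun _ => (ρ_ _).inv)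
      hom_inv_id := hom_mk_congr fun _ => Iso.hom_inv_id _
      inv_hom_id := hom_mk_congr fun _ => Iso.inv_hom_id _ }

/-- The monoidal category `(ΣD, e, ⊙)`: the free coproduct completion with Day convolution. -/
instance monoidalCategory : MonoidalCategory (FormalCoproduct.{w} D) :=
  MonoidalCategory.ofTensorHom
    (id_tensorHom_id := fun _ _ => hom_mk_congr fun _ => id_tensorHom_id _ _)
    (id_tensorHom := fun _ _ _ _ => rfl)
    (tensorHom_id := fun _ _ => rfl)
    (tensorHom_comp_tensorHom := fun _ _ _ _ =>
      hom_mk_congr fun _ => tensorHom_comp_tensorHom _ _ _ _)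
    (associator_naturality := fun _ _ _ => hom_mk_congr fun _ => associator_naturality _ _ _)
    (leftUnitor_naturality := fun f => hom_mk_congr fun p =>
      (congrArg (· ≫ _) (id_tensorHom _ _)).trans (leftUnitor_naturality (f.φ p.2)))
    (rightUnitor_naturality := fun f => hom_mk_congr fun p =>
      (congrArg (· ≫ _) (tensorHom_id _ _)).trans (rightUnitor_naturality (f.φ p.1)))
    (pentagon := fun _ _ _ _ => hom_mk_congr fun _ => pentagon_tensorHom _ _ _ _)
    (triangle := fun _ _ => hom_mk_congr fun _ => triangle_tensorHom _ _)

end DayFormalCoproduct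

/-- A small category enriched over `(ΣCᵒᵖ, e, ⊙)`. -/
structure SmallEnrichedCat (C : Type u) [Category.{v} C] [MonoidalCategory C] :
    Type (max u v (w + 1)) where
  /-- the set of objects -/
  Ob : Type w
  /-- the enriched category structure -/
  [enriched : EnrichedCategory (FormalCoproduct.{w} Cᵒᵖ) Ob]

namespace SmallEnrichedCat

attribute [instance] SmallEnrichedCat.enriched

variable {C : Type u} [Category.{v} C] [MonoidalCategory C]

section components

variable (A : SmallEnrichedCat.{w} C)

/-- The hom-set `A(x, y)`: the index set of the hom-object `∑ (f : x → y), |f|`. -/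
def Mor (x y : A.Ob) : Type w := (EnrichedCategory.Hom (V := FormalCoproduct.{w} Cᵒᵖ) x y).I

variable {A}

/-- The weight `|f|` of a morphism. -/
def weight {x y : A.Ob} (f : A.Mor x y) : C :=
  ((EnrichedCategory.Hom (V := FormalCoproduct.{w} Cᵒᵖ) x y).obj f).unop

/-- The identity morphism `id_x : x → x`. -/
def idMor (x : A.Ob) : A.Mor x x :=
  (eId (FormalCoproduct.{w} Cᵒᵖ) x).f PUnit.unit

/-- The identity map `η_x : |id_x| ⟶ e`. -/
def idMap (x : A.Ob) : weight (idMor x) ⟶ 𝟙_ C :=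
  ((eId (FormalCoproduct.{w} Cᵒᵖ) x).φ PUnit.unit).unop

/-- The composite `gf : x → z` of `f : x → y` and `g : y → z`. -/
def compMor {x y z : A.Ob} (f : A.Mor x y) (g : A.Mor y z) : A.Mor x z :=
  (eComp (FormalCoproduct.{w} Cᵒᵖ) x y z).f (f, g)

/-- The composite map `μ_{f,g} : |gf| ⟶ |f| ⊗ |g|`. -/
def compMap {x y z : A.Ob} (f : A.Mor x y) (g : A.Mor y z) :
    weight (compMor f g) ⟶ weight f ⊗ weight g :=
  ((eComp (FormalCoproduct.{w} Cᵒᵖ) x y z).φ (f, g)).unop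

end components

/-- A morphism `mor : a → cod` out of the object `a`, with a map `|mor| ⟶ c` from its weight. -/
structure WeightedMor {A : SmallEnrichedCat.{w} C} (a : A.Ob) (c : C) : Type (max v w) where
  /-- the codomain -/
  cod : A.Ob
  /-- the morphism -/
  mor : A.Mor a cod
  /-- the map from its weight -/
  map : weight mor ⟶ c

namespace WeightedMor

variable {A : SmallEnrichedCat.{w} C}

/-- Postcompose the map from the weight with `u : c ⟶ c'`. -/
def post {a : A.Ob} {c c' : C} (t : WeightedMor a c) (u : c ⟶ c') : WeightedMor a c' :=
  ⟨t.cod, t.mor, t.map ≫ u⟩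

/-- A morphism with the identity map of its weight. -/
def ofMor {x y : A.Ob} (f : A.Mor x y) : WeightedMor x (weight f) := ⟨y, f, 𝟙 _⟩

/-- `id_a : a → a` with `η_a : |id_a| ⟶ e`. -/
def unit (a : A.Ob) : WeightedMor a (𝟙_ C) := ⟨a, idMor a, idMap a⟩

/-- Given `f : a → x` with `p : |f| ⟶ c` and `g : x → y` with `q : |g| ⟶ c'`, the composite
`gf : a → y` with `|gf| ⟶ |f| ⊗ |g| ⟶ c ⊗ c'`. -/
def comp {a : A.Ob} {c c' : C} (t : WeightedMor a c) (s : WeightedMor t.cod c') :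
    WeightedMor a (c ⊗ c') :=
  ⟨s.cod, compMor t.mor s.mor, compMap t.mor s.mor ≫ (t.map ⊗ₘ s.map)⟩

end WeightedMor

/-- An enriched cofunctor `Φ : A ⇸ B`. The lift is written for a morphism `f : b → b'` of `B` and an
object `a` of `A` with `Φ a = b` (so that `f : Φ a → b'`); it consists of the codomain `x` and the
morphism `Φ♯_a f : a → x` of `A`, with `Φ x = b'`, and of the map `Φ_{a,f} : |Φ♯_a f| ⟶ |f|`. -/
structure EnrichedCofunctor (A B : SmallEnrichedCat.{w} C) : Type (max v w) where
  /-- the function on objects -/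
  obj : A.Ob → B.Ob
  /-- the lifts `Φ♯_a f`, with the maps `Φ_{a,f}` -/
  lift {a : A.Ob} {b b' : B.Ob} (h : obj a = b) (f : B.Mor b b') : WeightedMor a (weight f)
  /-- the codomain of `Φ♯_a f` is sent to the codomain of `f` -/
  obj_cod {a : A.Ob} {b b' : B.Ob} (h : obj a = b) (f : B.Mor b b') : obj (lift h f).cod = b'
  /-- preservation of identities: `Φ♯_a id = id_a`, and `Φ_{a,id} ≫ η_{Φ a} = η_a` -/
  lift_id {a : A.Ob} {b : B.Ob} (h : obj a = b) :
    (lift h (idMor b)).post (idMap b) = WeightedMor.unit a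
  /-- preservation of composites: `Φ♯_a (gf) = Φ♯_x g ∘ Φ♯_a f` for `Φ♯_a f : a → x`, and
  `Φ_{a,gf} ≫ μ_{f,g} = μ_{Φ♯_a f, Φ♯_x g} ≫ (Φ_{a,f} ⊗ Φ_{x,g})` -/
  lift_comp {a : A.Ob} {b b' b'' : B.Ob} (h : obj a = b) (f : B.Mor b b') (g : B.Mor b' b'') :
    (lift h (compMor f g)).post (compMap f g) = (lift h f).comp (lift (obj_cod h f) g)

namespace EnrichedCofunctor

variable {A B D : SmallEnrichedCat.{w} C}

theorem ext' {F G : EnrichedCofunctor A B} (h₁ : ∀ a, F.obj a = G.obj a)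
    (h₂ : ∀ {a : A.Ob} {b b' : B.Ob} (hF : F.obj a = b) (hG : G.obj a = b) (f : B.Mor b b'),
      F.lift hF f = G.lift hG f) : F = G := by
  obtain ⟨o, l, _, _, _⟩ := F
  obtain ⟨o', l', _, _, _⟩ := G
  obtain rfl : o = o' := funext h₁
  have hl : @l = @l' := by
    funext a b b' h f
    exact h₂ h h f
  subst hl
  rfl

/-- Lift a weighted morphism along a cofunctor: `|Φ♯_a k| ⟶ |k| ⟶ c`. -/
def push (F : EnrichedCofunctor A B) {a : A.Ob} {b : B.Ob} {c : C} (h : F.obj a = b)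
    (t : WeightedMor b c) : WeightedMor a c :=
  (F.lift h t.mor).post t.map

theorem push_post (F : EnrichedCofunctor A B) {a : A.Ob} {b : B.Ob} {c c' : C} (h : F.obj a = b)
    (t : WeightedMor b c) (u : c ⟶ c') : F.push h (t.post u) = (F.push h t).post u := by
  simp [push, WeightedMor.post]

theorem push_unit (F : EnrichedCofunctor A B) {a : A.Ob} {b : B.Ob} (h : F.obj a = b) :
    F.push h (WeightedMor.unit b) = WeightedMor.unit a :=
  F.lift_id h

theorem push_comp (F : EnrichedCofunctor A B) {a : A.Ob} {b : B.Ob} {c c' : C} (h : F.obj a = b)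
    (t : WeightedMor b c) (s : WeightedMor t.cod c') :
    F.push h (t.comp s) = (F.push h t).comp (F.push (F.obj_cod h t.mor) s) := by
  have := congrArg (fun r => r.post (t.map ⊗ₘ s.map)) (F.lift_comp h t.mor s.mor)
  simpa [push, WeightedMor.post, WeightedMor.comp] using this

theorem push_lift (F : EnrichedCofunctor A B) (G : EnrichedCofunctor B D) {a : A.Ob} {b : B.Ob}
    {d d' : D.Ob} (h : F.obj a = b) (hG : G.obj b = d) (hG' : G.obj (F.obj a) = d)
    (f : D.Mor d d') : F.push h (G.lift hG f) = F.push rfl (G.lift hG' f) := by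
  subst h
  rfl

/-- The identity cofunctor. -/
def id (A : SmallEnrichedCat.{w} C) : EnrichedCofunctor A A where
  obj a := a
  lift h f := h.symm ▸ WeightedMor.ofMor f
  obj_cod := by rintro a _ b' rfl f; rfl
  lift_id := by
    rintro a _ rfl
    simp [WeightedMor.post, WeightedMor.ofMor, WeightedMor.unit]
  lift_comp := by
    rintro a _ b' b'' rfl f g
    simp [WeightedMor.post, WeightedMor.ofMor, WeightedMor.comp]

/-- The composite cofunctor, with lifts `(Ψ ∘ Φ)♯_a f = Φ♯_a (Ψ♯_{Φ a} f)`. -/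
def comp (F : EnrichedCofunctor A B) (G : EnrichedCofunctor B D) : EnrichedCofunctor A D where
  obj a := G.obj (F.obj a)
  lift h f := F.push rfl (G.lift h f)
  obj_cod h f := (congrArg G.obj (F.obj_cod rfl _)).trans (G.obj_cod h f)
  lift_id h := by rw [← push_post, G.lift_id, push_unit]
  lift_comp h f g := by
    rw [← push_post, G.lift_comp, push_comp]
    exact congrArg _ (push_lift F G _ _ _ g)

end EnrichedCofunctor

/-- The category of small `(ΣCᵒᵖ, e, ⊙)`-enriched categories and enriched cofunctors. -/
instance category : Category (SmallEnrichedCat.{w} C) where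
  Hom := EnrichedCofunctor
  id := EnrichedCofunctor.id
  comp := EnrichedCofunctor.comp
  id_comp F := EnrichedCofunctor.ext' (fun _ => rfl) (by
    rintro a _ b' rfl hG f
    simp [EnrichedCofunctor.comp, EnrichedCofunctor.id, EnrichedCofunctor.push,
      WeightedMor.post, WeightedMor.ofMor])
  comp_id F := EnrichedCofunctor.ext' (fun _ => rfl) (by
    rintro a _ b' rfl hG f
    simp [EnrichedCofunctor.comp, EnrichedCofunctor.id, EnrichedCofunctor.push,
      WeightedMor.post, WeightedMor.ofMor])
  assoc F G H := EnrichedCofunctor.ext' (fun _ => rfl) (by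
    rintro a _ b' rfl hG f
    simp [EnrichedCofunctor.comp, EnrichedCofunctor.push, WeightedMor.post])

end SmallEnrichedCat

/-!
The right counit law of a comonoid `P` forces the position function of `Δ : P ⟶ P ◁ P` to be of the
form `i ↦ (i, cod i)`. Regard a direction `a` at `i` as a morphism `i → cod i a`: then the direction
functions of `ε` and `Δ` are identities and composites, their predicate maps are `η` and `μ`, and
what remains of the comonoid laws are the axioms of an enriched category. In the same way, a
morphism of polynomials commutes with `ε` and `Δ` exactly if its backward direction functions are
the lifts of an enriched cofunctor. So an enriched category and its outfacing polynomial
`∑ x, ∏ (y, f : x → y), |f|` with the induced comonoid structure are the same data, up to replacing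
the directions at `x` by pairs of a codomain and a morphism.
-/

namespace PolyIn

section Lift

variable {C : Type u} [Category.{v} C] {P Q R : PolyIn.{w} C}

/-- A direction of `P` at `i` together with a map from its predicate to `c`. These are the
components of a morphism of polynomials and, for varying `c`, the analogue for polynomials of
`SmallEnrichedCat.WeightedMor`. -/
structure WeightedDir (P : PolyIn.{w} C) (i : P.pos) (c : C) : Type (max v w) where
  dir : P.dir i
  map : P.pred i dir ⟶ c

namespace WeightedDir

/-- Postcomposition of the map from the predicate with `u : c ⟶ c'`. -/
def post {i : P.pos} {c c' : C} (t : WeightedDir P i c) (u : c ⟶ c') : WeightedDir P i c' :=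
  ⟨t.dir, t.map ≫ u⟩

/-- A direction with the identity map of its predicate. -/
def ofDir {i : P.pos} (a : P.dir i) : WeightedDir P i (P.pred i a) := ⟨a, 𝟙 _⟩

theorem post_hom_eq_iff {i : P.pos} {c c' : C} {t : WeightedDir P i c} {s : WeightedDir P i c'}
    (e : c ≅ c') : t.post e.hom = s ↔ t = s.post e.inv := by
  constructor <;> rintro rfl <;> simp [post]

theorem post_hom_eq_ofDir_iff {i : P.pos} {c : C} {t : WeightedDir P i c} {a : P.dir i}
    (e : c ≅ P.pred i a) : t.post e.hom = ofDir a ↔ t = ⟨a, e.inv⟩ := by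
  rw [post_hom_eq_iff, post, ofDir, Category.id_comp]

end WeightedDir

namespace Hom

/-- The component of a morphism `f` of polynomials at a direction `b` of `Q` at `j`, where `j` is
only propositionally equal to `f.onPos i`: this is what makes equations between morphisms with
different position functions expressible without casts. -/
def lift (f : P ⟶ Q) {i : P.pos} {j : Q.pos} (h : f.onPos i = j) (b : Q.dir j) :
    WeightedDir P i (Q.pred j b) := by
  subst h
  exact ⟨f.onDir i b, f.onPred i b⟩

/-- The action of a morphism of polynomials on weighted directions. -/
def pull (f : P ⟶ Q) {i : P.pos} {j : Q.pos} {c : C} (h : f.onPos i = j)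
    (t : WeightedDir Q j c) : WeightedDir P i c :=
  (lift f h t.dir).post t.map

end Hom

theorem lift_comp (f : P ⟶ Q) (g : Q ⟶ R) {i : P.pos} {j : Q.pos} {k : R.pos}
    (hf : f.onPos i = j) (h : Hom.onPos (f ≫ g) i = k) (c : R.dir k) :
    Hom.lift (f ≫ g) h c =
      Hom.pull f hf (Hom.lift g ((congrArg g.onPos hf).symm.trans h) c) := by
  subst hf h
  rfl

theorem hom_eq_iff {f g : P ⟶ Q} {q : P.pos → Q.pos} (hf : ∀ i, f.onPos i = q i) :
    f = g ↔ ∃ hg : ∀ i, g.onPos i = q i,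
      ∀ i b, Hom.lift f (hf i) b = Hom.lift g (hg i) b := by
  constructor
  · rintro rfl
    exact ⟨hf, fun _ _ => rfl⟩
  · rintro ⟨hg, h⟩
    obtain ⟨p, d, m⟩ := f
    obtain ⟨p', d', m'⟩ := g
    obtain rfl : p = q := funext hf
    obtain rfl : p' = p := funext hg
    obtain rfl : d = d' := funext₂ fun i b => congrArg WeightedDir.dir (h i b)
    exact hom_mk_congr fun i b => eq_of_heq (WeightedDir.mk.inj (h i b)).2

end Lift

section Comonoid

open ComonObj

variable {C : Type u} [Category.{v} C] [MonoidalCategory C]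

/-- A weighted direction of a composition product from weighted directions of its factors. -/
def WeightedDir.pair {P Q : PolyIn.{w} C} {x : (P ⊗ Q).pos} {c c' : C}
    (t : WeightedDir P x.1 c) (s : WeightedDir Q (x.2 t.dir) c') :
    WeightedDir (P ⊗ Q) x (c ⊗ c') :=
  ⟨⟨t.dir, s.dir⟩, t.map ⊗ₘ s.map⟩

theorem onPos_snd_of_onPos_tensorHom {P P' Q Q' : PolyIn.{w} C} {f : P ⟶ P'} {g : Q ⟶ Q'}
    {x : (P ⊗ Q).pos} {y : (P' ⊗ Q').pos} (h : Hom.onPos (f ⊗ₘ g) x = y) (a : P'.dir y.1) :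
    g.onPos (x.2 (Hom.lift f (congrArg Sigma.fst h) a).dir) = y.2 a := by
  subst h
  rfl

theorem lift_tensorHom {P P' Q Q' : PolyIn.{w} C} (f : P ⟶ P') (g : Q ⟶ Q')
    {x : (P ⊗ Q).pos} {y : (P' ⊗ Q').pos} (h : Hom.onPos (f ⊗ₘ g) x = y)
    (a : P'.dir y.1) (b : Q'.dir (y.2 a)) :
    Hom.lift (f ⊗ₘ g) h ⟨a, b⟩ = (Hom.lift f (congrArg Sigma.fst h) a).pair
      (Hom.lift g (onPos_snd_of_onPos_tensorHom h a) b) := by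
  subst h
  rfl

variable {P Q : PolyIn.{w} C} [ComonObj P] [ComonObj Q]

theorem fst_onPos_comul (i : P.pos) : (Hom.onPos Δ[P] i).1 = i :=
  congrArg Sigma.fst (congrFun (congrArg Hom.onPos (comul_counit P)) i)

/-- The codomain of a direction of a comonoid: directions at `i` are seen as morphisms out of `i`.
The right counit law provides the cast. -/
def cod (i : P.pos) : P.dir i → P.pos :=
  fst_onPos_comul i ▸ (Hom.onPos Δ[P] i).2

theorem onPos_comul (i : P.pos) : Hom.onPos Δ[P] i = ⟨i, cod i⟩ := by
  have eq_mk {x : (P ⊗ P).pos} (h : x.1 = i) : x = ⟨i, h ▸ x.2⟩ := by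
    subst h
    rfl
  exact eq_mk (fst_onPos_comul i)

/-- The identity direction of a comonoid at `i`, with its map to the unit. -/
def idDir (i : P.pos) : WeightedDir P i (𝟙_ C) :=
  Hom.lift ε[P] rfl PUnit.unit

/-- The composite of a direction `a` at `i` and a direction `b` at its codomain, with its map to
the tensor product of the predicates. -/
def compDir {i j : P.pos} (a : P.dir i) (h : cod i a = j) (b : P.dir j) :
    WeightedDir P i (P.pred i a ⊗ P.pred j b) := by
  subst h
  exact Hom.lift Δ[P] (onPos_comul i) ⟨a, b⟩

/-- The composite of weighted directions of a comonoid. -/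
def WeightedDir.comp {i j : P.pos} {c c' : C} (t : WeightedDir P i c) (h : cod i t.dir = j)
    (s : WeightedDir P j c') : WeightedDir P i (c ⊗ c') :=
  (compDir t.dir h s.dir).post (t.map ⊗ₘ s.map)

theorem ofDir_comp_ofDir {i j : P.pos} (a : P.dir i) (h : cod i a = j) (b : P.dir j) :
    (WeightedDir.ofDir a).comp h (.ofDir b) = compDir a h b := by
  simp [WeightedDir.comp, WeightedDir.ofDir, WeightedDir.post]

theorem pull_comul_pair_lift_id {i j : P.pos} {c : C} (t : WeightedDir P i c)
    (h : cod i t.dir = j) (b : P.dir j) :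
    Hom.pull Δ[P] (onPos_comul i) (t.pair (x := ⟨i, cod i⟩) (Hom.lift (𝟙 P) h b)) =
      t.comp h (.ofDir b) := by
  subst h
  rfl

/- Both counit laws, coassociativity, and compatibility of a morphism with comultiplications are
equations of this shape. -/
theorem eq_comul_comp_tensorHom_iff {P' Q' : PolyIn.{w} C} {k : P ⟶ P' ⊗ Q'} {f : P ⟶ P'}
    {g : P ⟶ Q'} {q : P.pos → (P' ⊗ Q').pos} (hk : ∀ i, k.onPos i = q i) :
    k = Δ[P] ≫ (f ⊗ₘ g) ↔ ∃ h : ∀ i, Hom.onPos (f ⊗ₘ g) ⟨i, cod i⟩ = q i,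
      ∀ i (a : P'.dir (q i).1) (b : Q'.dir ((q i).2 a)), Hom.lift k (hk i) ⟨a, b⟩ =
        Hom.pull Δ[P] (onPos_comul i) ((Hom.lift f (congrArg Sigma.fst (h i)) a).pair
          (Hom.lift g (onPos_snd_of_onPos_tensorHom (h i) a) b)) := by
  have onPos_eq (i : P.pos) :
      Hom.onPos (Δ[P] ≫ (f ⊗ₘ g)) i = Hom.onPos (f ⊗ₘ g) ⟨i, cod i⟩ :=
    congrArg (Hom.onPos (f ⊗ₘ g)) (onPos_comul i)
  have lift_eq {i : P.pos} (h : Hom.onPos (f ⊗ₘ g) ⟨i, cod i⟩ = q i) (a : P'.dir (q i).1)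
      (b : Q'.dir ((q i).2 a)) : Hom.lift (Δ[P] ≫ (f ⊗ₘ g)) ((onPos_eq i).trans h) ⟨a, b⟩ =
        Hom.pull Δ[P] (onPos_comul i) ((Hom.lift f (congrArg Sigma.fst h) a).pair
          (Hom.lift g (onPos_snd_of_onPos_tensorHom h a) b)) :=
    (lift_comp Δ[P] (f ⊗ₘ g) (onPos_comul i) _ _).trans
      (congrArg (Hom.pull Δ[P] (onPos_comul i)) (lift_tensorHom f g h a b))
  rw [hom_eq_iff hk]
  constructor
  · rintro ⟨hpos, hlift⟩
    have h (i : P.pos) := (onPos_eq i).symm.trans (hpos i)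
    exact ⟨h, fun i a b => (hlift i ⟨a, b⟩).trans (lift_eq (h i) a b)⟩
  · rintro ⟨h, hlift⟩
    exact ⟨fun i => (onPos_eq i).trans (h i), fun i ⟨a, b⟩ =>
      (hlift i a b).trans (lift_eq (h i) a b).symm⟩

theorem cod_idDir (i : P.pos) : cod i (idDir i).dir = i := by
  have counit_comul : (λ_ P).inv = Δ[P] ≫ (ε[P] ⊗ₘ 𝟙 P) := (ComonObj.counit_comul P).symm
  obtain ⟨hpos, _⟩ := (eq_comul_comp_tensorHom_iff fun _ => rfl).1 counit_comul
  exact onPos_snd_of_onPos_tensorHom (hpos i) PUnit.unit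

theorem idDir_comp {i : P.pos} (b : P.dir i) :
    ((idDir i).comp (cod_idDir i) (.ofDir b)).post (λ_ _).hom = .ofDir b := by
  have counit_comul : (λ_ P).inv = Δ[P] ≫ (ε[P] ⊗ₘ 𝟙 P) := (ComonObj.counit_comul P).symm
  obtain ⟨_, hlift⟩ := (eq_comul_comp_tensorHom_iff fun _ => rfl).1 counit_comul
  exact (WeightedDir.post_hom_eq_ofDir_iff (λ_ (P.pred i b))).2
    ((pull_comul_pair_lift_id _ _ b).symm.trans (hlift i PUnit.unit b).symm)

theorem comp_idDir {i j : P.pos} (a : P.dir i) (h : cod i a = j) :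
    ((WeightedDir.ofDir a).comp h (idDir j)).post (ρ_ _).hom = .ofDir a := by
  have comul_counit : (ρ_ P).inv = Δ[P] ≫ (𝟙 P ⊗ₘ ε[P]) := (ComonObj.comul_counit P).symm
  obtain ⟨_, hlift⟩ := (eq_comul_comp_tensorHom_iff fun _ => rfl).1 comul_counit
  subst h
  exact (WeightedDir.post_hom_eq_ofDir_iff (ρ_ (P.pred i a))).2 (hlift i a PUnit.unit).symm

theorem onPos_id_tensorHom_comul (i : P.pos) :
    Hom.onPos (𝟙 P ⊗ₘ Δ[P]) ⟨i, cod i⟩ = ⟨i, fun a => ⟨cod i a, cod (cod i a)⟩⟩ :=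
  congrArg (Sigma.mk i) (funext fun a => onPos_comul (cod i a))

theorem onPos_comul_comp_id_tensorHom_comul (i : P.pos) :
    Hom.onPos (Δ[P] ≫ (𝟙 P ⊗ₘ Δ[P]) ≫ (α_ P P P).inv) i =
      ⟨⟨i, cod i⟩, fun x => cod (cod i x.1) x.2⟩ :=
  congrArg (Hom.onPos (α_ P P P).inv)
    ((congrArg (Hom.onPos (𝟙 P ⊗ₘ Δ[P])) (onPos_comul i)).trans (onPos_id_tensorHom_comul i))

theorem lift_comul_comp_id_tensorHom_comul {i : P.pos} (a : P.dir i) (b : P.dir (cod i a))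
    (c : P.dir (cod (cod i a) b)) :
    Hom.lift (Δ[P] ≫ (𝟙 P ⊗ₘ Δ[P]) ≫ (α_ P P P).inv) (onPos_comul_comp_id_tensorHom_comul i)
        ⟨⟨a, b⟩, c⟩ =
      ((WeightedDir.ofDir a).comp rfl (compDir b rfl c)).post (α_ _ _ _).inv := by
  have lift_id_tensorHom_comul : Hom.lift ((𝟙 P ⊗ₘ Δ[P]) ≫ (α_ P P P).inv)
      (congrArg (Hom.onPos (α_ P P P).inv) (onPos_id_tensorHom_comul i)) ⟨⟨a, b⟩, c⟩ =
        ((WeightedDir.ofDir a).pair (x := ⟨i, cod i⟩) (compDir b rfl c)).post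
          (α_ _ _ _).inv :=
    (lift_comp _ (α_ P P P).inv (onPos_id_tensorHom_comul i) _ _).trans
      (congrArg (WeightedDir.post · (α_ _ _ _).inv)
        (lift_tensorHom (𝟙 P) Δ[P] (onPos_id_tensorHom_comul i) a ⟨b, c⟩))
  exact (lift_comp Δ[P] _ (onPos_comul i) _ _).trans
    ((congrArg (Hom.pull Δ[P] (onPos_comul i)) lift_id_tensorHom_comul).trans
      (congrArg (WeightedDir.mk _) (Category.assoc _ _ _).symm))

theorem cod_compDir {i j : P.pos} (a : P.dir i) (h : cod i a = j) (b : P.dir j) :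
    cod i (compDir a h b).dir = cod j b := by
  obtain ⟨hpos, _⟩ := (eq_comul_comp_tensorHom_iff onPos_comul_comp_id_tensorHom_comul).1
    (comul_assoc_flip P).symm
  subst h
  exact onPos_snd_of_onPos_tensorHom (hpos i) ⟨a, b⟩

theorem compDir_assoc {i j k : P.pos} (a : P.dir i) (h : cod i a = j) (b : P.dir j)
    (h' : cod j b = k) (c : P.dir k) :
    (WeightedDir.ofDir a).comp h (compDir b h' c) =
      ((compDir a h b).comp ((cod_compDir a h b).trans h') (.ofDir c)).post (α_ _ _ _).hom := by
  obtain ⟨_, hlift⟩ := (eq_comul_comp_tensorHom_iff onPos_comul_comp_id_tensorHom_comul).1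
    (comul_assoc_flip P).symm
  subst h h'
  exact (WeightedDir.post_hom_eq_iff (α_ _ _ _).symm).1
    ((lift_comul_comp_id_tensorHom_comul a b c).symm.trans ((hlift i ⟨a, b⟩ c).trans
      (pull_comul_pair_lift_id (compDir a rfl b) _ c)))

theorem comp_counit_eq_iff {f : P ⟶ Q} :
    f ≫ ε[Q] = ε[P] ↔ ∀ i, Hom.pull f rfl (idDir (f.onPos i)) = idDir i := by
  refine (hom_eq_iff fun _ => rfl).trans ⟨fun ⟨_, h⟩ i => h i PUnit.unit, fun h => ?_⟩
  exact ⟨fun _ => rfl, fun i _ => h i⟩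

theorem comp_comul_eq_iff {f : P ⟶ Q} :
    f ≫ Δ[Q] = Δ[P] ≫ (f ⊗ₘ f) ↔
      ∃ hcod : ∀ i b, f.onPos (cod i (f.onDir i b)) = cod (f.onPos i) b,
        ∀ i a b, Hom.pull f rfl (compDir a rfl b) =
          (Hom.lift f rfl a).comp rfl (Hom.lift f (hcod i a) b) := by
  have onPos_eq (i : P.pos) : Hom.onPos (f ≫ Δ[Q]) i = ⟨f.onPos i, cod (f.onPos i)⟩ :=
    onPos_comul (f.onPos i)
  have lift_eq {i : P.pos} (a : Q.dir (f.onPos i)) (b : Q.dir (cod (f.onPos i) a)) :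
      Hom.lift (f ≫ Δ[Q]) (onPos_eq i) ⟨a, b⟩ = Hom.pull f rfl (compDir a rfl b) :=
    lift_comp f Δ[Q] rfl _ _
  rw [eq_comul_comp_tensorHom_iff onPos_eq]
  constructor
  · rintro ⟨hpos, hlift⟩
    refine ⟨fun i b => onPos_snd_of_onPos_tensorHom (hpos i) b, fun i a b => ?_⟩
    exact (lift_eq a b).symm.trans (hlift i a b)
  · rintro ⟨hcod, hlift⟩
    refine ⟨fun i => congrArg (Sigma.mk _) (funext (hcod i)), fun i a b => ?_⟩
    exact (lift_eq a b).trans (hlift i a b)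

end Comonoid

end PolyIn

namespace SmallEnrichedCat

open ComonObj PolyIn

variable {C : Type u} [Category.{v} C] [MonoidalCategory C]

section Laws

variable {A : SmallEnrichedCat.{w} C}

theorem WeightedMor.mk_eq_of_hom_eq {x y : A.Ob} {X : FormalCoproduct.{w} Cᵒᵖ}
    {k k' : X ⟶ EnrichedCategory.Hom x y} (e : k = k') (i : X.I) :
    (⟨y, k.f i, (k.φ i).unop⟩ : WeightedMor x (X.obj i).unop) = ⟨y, k'.f i, (k'.φ i).unop⟩ := by
  rw [e]

theorem unit_comp {x y : A.Ob} (f : A.Mor x y) :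
    ((WeightedMor.unit x).comp (.ofMor f)).post (λ_ _).hom = .ofMor f :=
  WeightedMor.mk_eq_of_hom_eq (e_id_comp (FormalCoproduct.{w} Cᵒᵖ) x y) f

theorem comp_unit {x y : A.Ob} (f : A.Mor x y) :
    ((WeightedMor.ofMor f).comp (.unit y)).post (ρ_ _).hom = .ofMor f :=
  WeightedMor.mk_eq_of_hom_eq (e_comp_id (FormalCoproduct.{w} Cᵒᵖ) x y) f

theorem compMor_assoc {x y z t : A.Ob} (f : A.Mor x y) (g : A.Mor y z) (h : A.Mor z t) :
    (WeightedMor.ofMor f).comp ⟨t, compMor g h, compMap g h⟩ =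
      (WeightedMor.comp ⟨z, compMor f g, compMap f g⟩ (.ofMor h)).post (α_ _ _ _).hom :=
  WeightedMor.mk_eq_of_hom_eq (e_assoc (FormalCoproduct.{w} Cᵒᵖ) x y z t).symm (f, g, h)

end Laws

/-- The outfacing polynomial `∑ x, ∏ (y, f : x → y), |f|` of an enriched category. -/
def outPoly (A : SmallEnrichedCat.{w} C) : PolyIn.{w} C where
  pos := A.Ob
  dir x := Σ y, A.Mor x y
  pred _ f := weight f.2

/-- Weighted morphisms of an enriched category are the weighted directions of its outfacing
polynomial. -/
def weightedMorEquiv {A : SmallEnrichedCat.{w} C} {a : A.Ob} {c : C} :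
    WeightedMor a c ≃ WeightedDir A.outPoly a c where
  toFun t := ⟨⟨t.cod, t.mor⟩, t.map⟩
  invFun t := ⟨t.dir.1, t.dir.2, t.map⟩
  left_inv _ := rfl
  right_inv _ := rfl

instance outPolyComonObj (A : SmallEnrichedCat.{w} C) : ComonObj A.outPoly where
  counit := ⟨fun _ => PUnit.unit, fun x _ => ⟨x, idMor x⟩, fun x _ => idMap x⟩
  comul := ⟨fun x => ⟨x, fun f => f.1⟩, fun _ f => ⟨f.2.1, compMor f.1.2 f.2.2⟩,
    fun _ f => compMap f.1.2 f.2.2⟩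
  counit_comul := (hom_eq_iff fun _ => rfl).2
    ⟨fun _ => rfl, fun _ f => (WeightedDir.post_hom_eq_ofDir_iff (λ_ _)).1
      (congrArg weightedMorEquiv (unit_comp f.2.2))⟩
  comul_counit := (hom_eq_iff fun _ => rfl).2
    ⟨fun _ => rfl, fun _ f => (WeightedDir.post_hom_eq_ofDir_iff (ρ_ _)).1
      (congrArg weightedMorEquiv (comp_unit f.1.2))⟩
  comul_assoc := (hom_eq_iff fun _ => rfl).2 ⟨fun _ => rfl, fun _ f =>
    (congrArg weightedMorEquiv (compMor_assoc f.1.2 f.2.1.2 f.2.2.2)).trans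
      (congrArg (WeightedDir.mk _) (Category.assoc _ _ _))⟩

variable {A B : SmallEnrichedCat.{w} C}

/-- The morphism of outfacing polynomials underlying an enriched cofunctor. -/
def EnrichedCofunctor.polyHom (F : EnrichedCofunctor A B) : A.outPoly ⟶ B.outPoly :=
  ⟨F.obj, fun _ f => (weightedMorEquiv (F.lift rfl f.2)).dir,
    fun _ f => (weightedMorEquiv (F.lift rfl f.2)).map⟩

theorem lift_polyHom (F : EnrichedCofunctor A B) {a : A.Ob} {b b' : B.Ob} (h : F.obj a = b)
    (f : B.Mor b b') : Hom.lift F.polyHom h ⟨b', f⟩ = weightedMorEquiv (F.lift h f) := by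
  subst h
  rfl

instance isComonHom_polyHom (F : EnrichedCofunctor A B) : IsComonHom F.polyHom where
  hom_counit := comp_counit_eq_iff.2 fun _ => congrArg weightedMorEquiv (F.lift_id rfl)
  hom_comul := comp_comul_eq_iff.2 ⟨fun _ f => F.obj_cod rfl f.2, fun _ f g =>
    (congrArg weightedMorEquiv (F.lift_comp rfl f.2 g.2)).trans
      (congrArg ((Hom.lift F.polyHom rfl f).comp rfl) (lift_polyHom F _ g.2).symm)⟩

/-- The enriched cofunctor given by a comonoid morphism of outfacing polynomials. -/
def cofunctorOfPolyHom (f : A.outPoly ⟶ B.outPoly) [IsComonHom f] : EnrichedCofunctor A B where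
  obj := f.onPos
  lift h g := weightedMorEquiv.symm (Hom.lift f h ⟨_, g⟩)
  obj_cod := by
    rintro a _ b' rfl g
    exact (comp_comul_eq_iff.1 (IsComonHom.hom_comul f)).1 a ⟨b', g⟩
  lift_id := by
    rintro a _ rfl
    exact congrArg weightedMorEquiv.symm (comp_counit_eq_iff.1 (IsComonHom.hom_counit f) a)
  lift_comp := by
    rintro a _ b b' rfl g g'
    exact congrArg weightedMorEquiv.symm
      ((comp_comul_eq_iff.1 (IsComonHom.hom_comul f)).2 a ⟨b, g⟩ ⟨b', g'⟩)

variable (C) in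
/-- The functor that sends an enriched category to its outfacing polynomial. -/
def toComon : SmallEnrichedCat.{w} C ⥤ Comon (PolyIn.{w} C) where
  obj A := ⟨A.outPoly⟩
  map F := ⟨EnrichedCofunctor.polyHom F⟩
  map_id _ := rfl
  map_comp _ _ := rfl

variable (C) in
/-- Comonoid morphisms of outfacing polynomials are enriched cofunctors. -/
def toComonFullyFaithful : (toComon.{w} C).FullyFaithful where
  preimage {A B} f :=
    have : IsComonHom (M := A.outPoly) (N := B.outPoly) f.hom := f.isComonHom_hom
    cofunctorOfPolyHom f.hom
  map_preimage _ := rfl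
  preimage_map F := EnrichedCofunctor.ext' (fun _ => rfl) fun h _ g =>
    congrArg weightedMorEquiv.symm (lift_polyHom F h g)

end SmallEnrichedCat

namespace PolyIn

open ComonObj SmallEnrichedCat

variable {C : Type u} [Category.{v} C] [MonoidalCategory C] (P : PolyIn.{w} C) [ComonObj P]

/-- The hom-object `∑ (a : i → j), |a|` of a comonoid. -/
def homObj (i j : P.pos) : FormalCoproduct.{w} Cᵒᵖ :=
  ⟨{a : P.dir i // cod i a = j}, fun a => Opposite.op (P.pred i a.1)⟩

variable {P}

theorem homObj_hom_ext {i j : P.pos} {X : FormalCoproduct.{w} Cᵒᵖ} {k k' : X ⟶ P.homObj i j}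
    (h : ∀ x, (⟨(k.f x).1, (k.φ x).unop⟩ : WeightedDir P i (X.obj x).unop) =
      ⟨(k'.f x).1, (k'.φ x).unop⟩) : k = k' := by
  obtain ⟨f, φ⟩ := k
  obtain ⟨f', φ'⟩ := k'
  obtain rfl : f = f' := funext fun x => Subtype.ext (congrArg WeightedDir.dir (h x))
  exact DayFormalCoproduct.hom_mk_congr fun x =>
    Quiver.Hom.unop_inj (eq_of_heq (WeightedDir.mk.inj (h x)).2)

variable (P) in
/-- The enriched category of a comonoid: its morphisms are the directions. -/
def toEnrichedCat : SmallEnrichedCat.{w} C where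
  Ob := P.pos
  enriched :=
    { Hom := P.homObj
      id i := ⟨fun _ => ⟨(idDir i).dir, cod_idDir i⟩, fun _ => (idDir i).map.op⟩
      comp _ _ _ := ⟨fun x => ⟨(compDir x.1.1 x.1.2 x.2.1).dir, (cod_compDir _ _ _).trans x.2.2⟩,
        fun x => (compDir x.1.1 x.1.2 x.2.1).map.op⟩
      id_comp _ _ := homObj_hom_ext fun x => idDir_comp x.1
      comp_id _ _ := homObj_hom_ext fun x => comp_idDir x.1 x.2
      assoc _ _ _ _ := homObj_hom_ext fun x =>
        (compDir_assoc x.1.1 x.1.2 x.2.1.1 x.2.1.2 x.2.2.1).symm }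

variable (P) in
/-- The outfacing polynomial of the enriched category of a comonoid recovers the comonoid. -/
def outPolyIso : P.toEnrichedCat.outPoly ≅ P where
  hom := ⟨fun i => i, fun i a => ⟨cod i a, ⟨a, rfl⟩⟩, fun i a => 𝟙 (P.pred i a)⟩
  inv := ⟨fun i => i, fun i x => x.2.1, fun i x => 𝟙 (P.pred i x.2.1)⟩
  hom_inv_id := (hom_eq_iff fun _ => rfl).2 ⟨fun _ => rfl, by
    rintro i ⟨_, a, rfl⟩
    exact congrArg (WeightedDir.mk _) (Category.id_comp _)⟩
  inv_hom_id := hom_mk_congr fun _ _ => Category.id_comp _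

theorem pull_outPolyIso_hom {i j : P.pos} {c : C} (t : WeightedDir P i c) (h : cod i t.dir = j) :
    Hom.pull P.outPolyIso.hom rfl t = ⟨⟨j, t.dir, h⟩, t.map⟩ := by
  subst h
  exact congrArg (WeightedDir.mk _) (Category.id_comp _)

theorem outPolyIso_hom_counit : P.outPolyIso.hom ≫ ε[P] = ε[P.toEnrichedCat.outPoly] :=
  comp_counit_eq_iff.2 fun (i : P.pos) => pull_outPolyIso_hom (idDir i) (cod_idDir i)

theorem outPolyIso_hom_comul :
    P.outPolyIso.hom ≫ Δ[P] =
      Δ[P.toEnrichedCat.outPoly] ≫ (P.outPolyIso.hom ⊗ₘ P.outPolyIso.hom) :=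
  comp_comul_eq_iff.2 ⟨fun _ _ => rfl, fun (_ : P.pos) a b =>
    (congrArg (Hom.pull P.outPolyIso.hom rfl) (ofDir_comp_ofDir a rfl b).symm).trans
      (pull_outPolyIso_hom ((WeightedDir.ofDir a).comp rfl (.ofDir b)) (cod_compDir a rfl b))⟩

end PolyIn

namespace SmallEnrichedCat

variable {C : Type u} [Category.{v} C] [MonoidalCategory C]

instance : (toComon.{w} C).EssSurj where
  mem_essImage M := ⟨M.X.toEnrichedCat,
    ⟨Comon.mkIso (M := (toComon C).obj M.X.toEnrichedCat) M.X.outPolyIso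
      PolyIn.outPolyIso_hom_counit PolyIn.outPolyIso_hom_comul⟩⟩

end SmallEnrichedCat

theorem mainTheorem1 (C : Type u) [Category.{v} C] [MonoidalCategory C] :
    Nonempty (Comon (PolyIn.{w} C) ≌ SmallEnrichedCat.{w} C) := by
  have := (SmallEnrichedCat.toComonFullyFaithful.{w} C).full
  have := (SmallEnrichedCat.toComonFullyFaithful.{w} C).faithful
  have : (SmallEnrichedCat.toComon.{w} C).IsEquivalence := {}
  exact ⟨(SmallEnrichedCat.toComon.{w} C).asEquivalence.symm⟩
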